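/- Let $n\ge 0$ and $k\ge 1$ be integers. The Yangian $\mathrm{Y}(n)=\mathrm{Y}(\mathfrak{gl}_n)$ is the complex associative algebra with generators $t_{ij}^{(r)}$ ($1\le i,j\le n$, $r\ge 1$) and the defining relations $$(u-v)\,[t_{ij}(u),t_{kl}(v)]=t_{kj}(u)\,t_{il}(v)-t_{kj}(v)\,t_{il}(u),\qquad t_{ij}(u)=\delta_{ij}+\sum_{r\ge 1}t_{ij}^{(r)}u^{-r},$$ where $u,v$ are formal commuting variables. It acts on tensor products of its modules through the coproduct $\Delta(t_{ij}(u))=\sum_{c=1}^n t_{ic}(u)\otimes t_{cj}(u)$. For $a\in\mathbb{C}$ there is an algebra homomorphism $$\varphi_a:\mathrm{Y}(n)\to \mathrm{U}(\mathfrak{gl}_n),\qquad t_{ij}(u)\mapsto \delta_{ij}+\frac{E_{ij}}{u-a},$$ where the $E_{ij}$ are the standard basis elements of $\mathfrak{gl}_n$. For an $n$-tuple $\lambda=(\lambda_1,\dots,\lambda_n)$ of complex numbers such that $\lambda_i-\lambda_{i+1}$ is a non-negative integer for each $i$, let $L(\lambda)$ be the irreducible finite-dimensional $\mathfrak{gl}_n$-module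 with highest weight $\lambda$ with respect to the upper triangular Borel subalgebra (it is unique up to isomorphism). Let $L_a(\lambda)$ denote the $\mathrm{Y}(n)$-module obtained from $L(\lambda)$ through $\varphi_a$; as a $\mathrm{Y}(n)$-module, $L(\lambda)$ means $L_0(\lambda)$. Put $I=(1,1,\dots,1)$. **Proposition.** Let $a_1,\dots,a_k\in\mathbb{C}$, and let $\lambda^{(1)},\dots,\lambda^{(k)}$ be $n$-tuples of complex numbers such that $\lambda^{(p)}_i-\lambda^{(p)}_{i+1}$ is a non-negative integer for all $i$ and $p$. Then the $\mathrm{Y}(n)$-module $$L_{a_1}(\lambda^{(1)})\otimes L_{a_2}(\lambda^{(2)})\otimes\cdots\otimes L_{a_k}(\lambda^{(k)})$$ is irreducible if and only if the $\mathrm{Y}(n)$-module $$L(\lambda^{(1)}-a_1 I)\otimes L(\lambda^{(2)}-a_2 I)\otimes\cdots\otimes L(\lambda^{(k)}-a_k I)$$ (all evaluation parameters equal to $0$) is irreducible. -/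

import Mathlib

universe u v

open scoped TensorProduct

attribute [local instance] LieRing.ofAssociativeRing

/-! ### The Yangian of `gl_n` -/

namespace Yangian

/-- The two-index families of series `t_ij(u) = δ_ij + t_ij^(1) u⁻¹ + t_ij^(2) u⁻² + ⋯` over a ring
`A` which satisfy the Yangian relations
`(u - v) [t_ij(u), t_kl(v)] = t_kj(u) t_il(v) - t_kj(v) t_il(u)`.
Here `t r i j` is the coefficient `t_ij^(r)` of `u⁻ʳ`, and the relation is written out as the
equality of the coefficients of `u⁻ʳ v⁻ˢ`; the remaining coefficients, those with a positive
power of `u` or of `v`, only say that the scalars `t_ij^(0)` are central. -/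
structure IsRTT {n : ℕ} {A : Type*} [Ring A] (t : ℕ → Fin n → Fin n → A) : Prop where
  zero : ∀ i j, t 0 i j = if i = j then 1 else 0
  rel : ∀ (r s : ℕ) (i j k l : Fin n),
    ⁅t (r + 1) i j, t s k l⁆ - ⁅t r i j, t (s + 1) k l⁆ =
      t r k j * t s i l - t s k j * t r i l

/-- The family `t_ij^(r)` in the free algebra on the generators `t_ij^(1), t_ij^(2), …`; the free
generator with index `(r, i, j)` stands for `t_ij^(r+1)`. -/
noncomputable def freeT (n : ℕ) : ℕ → Fin n → Fin n → FreeAlgebra ℂ (ℕ × Fin n × Fin n)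
  | 0, i, j => if i = j then 1 else 0
  | r + 1, i, j => FreeAlgebra.ι ℂ (r, i, j)

/-- The defining relations of the Yangian. -/
inductive Rel (n : ℕ) :
    FreeAlgebra ℂ (ℕ × Fin n × Fin n) → FreeAlgebra ℂ (ℕ × Fin n × Fin n) → Prop
  | intro (r s : ℕ) (i j k l : Fin n) :
    Rel n (⁅freeT n (r + 1) i j, freeT n s k l⁆ - ⁅freeT n r i j, freeT n (s + 1) k l⁆)
      (freeT n r k j * freeT n s i l - freeT n s k j * freeT n r i l)

end Yangian

/-- The Yangian `Y(n) = Y(gl_n)`: the complex associative algebra generated by the `t_ij^(r)`,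
`r ≥ 1`, subject to the defining relations. -/
abbrev Yangian (n : ℕ) : Type := RingQuot (Yangian.Rel n)

namespace Yangian

variable {n : ℕ}

/-- The element `t_ij^(r)` of the Yangian, with `t_ij^(0) = δ_ij`. -/
noncomputable def t (r : ℕ) (i j : Fin n) : Yangian n :=
  RingQuot.mkAlgHom ℂ (Rel n) (freeT n r i j)

theorem isRTT_t : IsRTT (t (n := n)) where
  zero i j := by
    unfold t freeT
    split_ifs with h <;> simp [h]
  rel r s i j k l := by
    have h := RingQuot.mkAlgHom_rel ℂ (Rel.intro r s i j k l)
    simpa only [t, Ring.lie_def, map_sub, map_mul] using h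

/-- The universal property of the Yangian. -/
noncomputable def lift {A : Type*} [Ring A] [Algebra ℂ A] (f : ℕ → Fin n → Fin n → A) (hf : IsRTT f) :
    Yangian n →ₐ[ℂ] A :=
  RingQuot.liftAlgHom ℂ
    ⟨FreeAlgebra.lift ℂ fun x : ℕ × Fin n × Fin n => f (x.1 + 1) x.2.1 x.2.2, by
      have key : ∀ r i j, FreeAlgebra.lift ℂ
          (fun x : ℕ × Fin n × Fin n => f (x.1 + 1) x.2.1 x.2.2) (freeT n r i j) = f r i j := by
        intro r i j
        cases r with
        | zero =>
          rw [hf.zero]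
          unfold freeT
          split_ifs with h <;> simp [h]
        | succ r => simp [freeT]
      rintro _ _ ⟨r, s, i, j, k, l⟩
      simp only [Ring.lie_def, map_sub, map_mul, key]
      simpa only [Ring.lie_def] using hf.rel r s i j k l⟩

theorem lift_t {A : Type*} [Ring A] [Algebra ℂ A] (f : ℕ → Fin n → Fin n → A) (hf : IsRTT f)
    (r : ℕ) (i j : Fin n) : lift f hf (t r i j) = f r i j := by
  unfold lift t
  rw [RingQuot.liftAlgHom_mkAlgHom_apply]
  cases r with
  | zero =>
    rw [hf.zero]
    unfold freeT
    split_ifs with h <;> simp [h]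
  | succ r => simp [freeT]

/-! ### The coproduct -/

/-- The coefficients of the matrix product `∑_a S_ia(u) T_aj(u)` of two families of series. -/
noncomputable def conv {A : Type*} [Ring A] (S T : ℕ → Fin n → Fin n → A) (r : ℕ) (i j : Fin n) : A :=
  ∑ a : Fin n, ∑ p ∈ Finset.HasAntidiagonal.antidiagonal r, S p.1 i a * T p.2 a j

/-- The series-level computation: `D = u - v` and `K = 1` up to a common central factor. -/
theorem conv_aux {B : Type*} [Ring B] (D K : B) (hD : ∀ b, D * b = b * D)
    (hK : ∀ b, K * b = b * K) (s s' t t' : Fin n → Fin n → B)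
    (hS : ∀ i j k l, D * (s i j * s' k l - s' k l * s i j) =
      K * (s k j * s' i l - s' k j * s i l))
    (hT : ∀ i j k l, D * (t i j * t' k l - t' k l * t i j) =
      K * (t k j * t' i l - t' k j * t i l))
    (h1 : ∀ i j k l, t i j * s' k l = s' k l * t i j)
    (h2 : ∀ i j k l, t' i j * s k l = s k l * t' i j)
    (i j k l : Fin n) :
    D * ((∑ a, s i a * t a j) * (∑ b, s' k b * t' b l) -
        (∑ b, s' k b * t' b l) * (∑ a, s i a * t a j)) =
      K * ((∑ a, s k a * t a j) * (∑ b, s' i b * t' b l) -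
        (∑ a, s' k a * t' a j) * (∑ b, s i b * t b l)) := by
  have e1 : ∀ i j k l, (∑ a, s i a * t a j) * (∑ b, s' k b * t' b l) =
      ∑ a, ∑ b, s i a * s' k b * (t a j * t' b l) := by
    intro i j k l
    rw [Finset.sum_mul_sum]
    refine Finset.sum_congr rfl fun a _ => Finset.sum_congr rfl fun b _ => ?_
    rw [mul_assoc, ← mul_assoc (t a j), h1]
    simp only [mul_assoc]
  have e2 : ∀ i j k l, (∑ b, s' k b * t' b l) * (∑ a, s i a * t a j) =
      ∑ b, ∑ a, s' k b * s i a * (t' b l * t a j) := by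
    intro i j k l
    rw [Finset.sum_mul_sum]
    refine Finset.sum_congr rfl fun a _ => Finset.sum_congr rfl fun b _ => ?_
    rw [mul_assoc, ← mul_assoc (t' a l), h2]
    simp only [mul_assoc]
  rw [e1, e2, e1, e2, Finset.sum_comm (f := fun b a => s' k b * s i a * (t' b l * t a j)),
    ← Finset.sum_sub_distrib, ← Finset.sum_sub_distrib, Finset.mul_sum, Finset.mul_sum]
  simp only [← Finset.sum_sub_distrib, Finset.mul_sum]
  have e3 : ∀ a b, D * (s i a * s' k b * (t a j * t' b l) - s' k b * s i a * (t' b l * t a j)) =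
      K * ((s k a * s' i b - s' k a * s i b) * (t a j * t' b l)) +
        K * (s' k b * s i a * (t b j * t' a l - t' b j * t a l)) := by
    intro a b
    have : D * (s i a * s' k b * (t a j * t' b l) - s' k b * s i a * (t' b l * t a j)) =
        (D * (s i a * s' k b - s' k b * s i a)) * (t a j * t' b l) +
          s' k b * s i a * (D * (t a j * t' b l - t' b l * t a j)) := by
      rw [← mul_assoc (s' k b * s i a) D, ← hD (s' k b * s i a)]
      noncomm_ring
    rw [this, hS, hT, ← mul_assoc (s' k b * s i a) K, ← hK (s' k b * s i a)]
    noncomm_ring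
  simp only [e3, Finset.sum_add_distrib]
  rw [Finset.sum_comm (f := fun a b => K * (s' k b * s i a * (t b j * t' a l - t' b j * t a l)))]
  simp only [← Finset.sum_add_distrib]
  refine Finset.sum_congr rfl fun a _ => Finset.sum_congr rfl fun b _ => ?_
  noncomm_ring

open PowerSeries in
/-- A product of two families satisfying the Yangian relations and commuting with each other
satisfies the Yangian relations. -/
theorem IsRTT.mul {A : Type*} [Ring A] {S T : ℕ → Fin n → Fin n → A} (hS : IsRTT S)
    (hT : IsRTT T) (hST : ∀ r s i j k l, S r i j * T s k l = T s k l * S r i j) :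
    IsRTT (conv S T) where
  zero i j := by
    simp [Yangian.conv, hS.zero, hT.zero]
  rel r s i j k l := by
    -- work in `A⟦x⟧⟦y⟧` with `x = u⁻¹`, `y = v⁻¹`
    let U : (ℕ → A) → A⟦X⟧⟦X⟧ := fun f => C (PowerSeries.mk f)
    let V : (ℕ → A) → A⟦X⟧⟦X⟧ := fun f => PowerSeries.mk fun s => C (f s)
    let x : A⟦X⟧⟦X⟧ := C X
    let y : A⟦X⟧⟦X⟧ := X
    have hUV : ∀ f g r s, coeff r (coeff s (U f * V g)) = f r * g s := by
      intro f g r s; simp [U, V]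
    have hVU : ∀ f g r s, coeff r (coeff s (V g * U f)) = g s * f r := by
      intro f g r s; simp [U, V]
    have hx : ∀ b, x * b = b * x := by
      intro b; ext s r; simp [x, X_mul]
    have hy : ∀ b, y * b = b * y := fun b => X_mul
    have cy0 : ∀ b : A⟦X⟧⟦X⟧, coeff 0 (y * b) = 0 := fun b => by simp [y]
    have cy : ∀ (b : A⟦X⟧⟦X⟧) s, coeff (s + 1) (y * b) = coeff s b :=
      fun b s => coeff_succ_X_mul s b
    have cx : ∀ (b : A⟦X⟧⟦X⟧) s, coeff s (x * b) = X * coeff s b := fun b s => by simp [x]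
    -- the relation in terms of series
    have series : ∀ {R : ℕ → Fin n → Fin n → A}, IsRTT R → ∀ i j k l,
        (y - x) * (U (R · i j) * V (R · k l) - V (R · k l) * U (R · i j)) =
          (x * y) * (U (R · k j) * V (R · i l) - V (R · k j) * U (R · i l)) := by
      intro R hR i j k l
      have c0 : ∀ i j (a : A), R 0 i j * a = a * R 0 i j := by
        intro i j a; rw [hR.zero]; split_ifs <;> simp
      ext s r
      rw [sub_mul, mul_assoc x y, map_sub, map_sub, cx, cx]
      rcases s with _ | s <;> rcases r with _ | r
      · simp [cy0]
      · simp only [cy0, coeff_succ_X_mul, map_sub, hUV, hVU, c0]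
        simp
      · simp only [cy, coeff_zero_X_mul, map_sub, hUV, hVU, c0]
        simp
      · simp only [cy, coeff_succ_X_mul, map_sub, hUV, hVU]
        have := hR.rel r s i j k l
        simp only [Ring.lie_def] at this
        exact this
    have hUV_comm : ∀ i j k l,
        U (T · i j) * V (S · k l) = V (S · k l) * U (T · i j) := by
      intro i j k l; ext s r; rw [hUV, hVU, hST]
    have hVU_comm : ∀ i j k l,
        V (T · i j) * U (S · k l) = U (S · k l) * V (T · i j) := by
      intro i j k l; ext s r; rw [hUV, hVU, hST]
    have main := conv_aux (y - x) (x * y) (fun b => by rw [sub_mul, mul_sub, hx, hy])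
      (fun b => by rw [mul_assoc, hy b, ← mul_assoc, hx b, mul_assoc])
      (fun i j => U (S · i j)) (fun i j => V (S · i j)) (fun i j => U (T · i j))
      (fun i j => V (T · i j)) (series hS) (series hT) hUV_comm hVU_comm i j k l
    have cU : ∀ i j, ∑ a, U (S · i a) * U (T · a j) = U (Yangian.conv S T · i j) := by
      intro i j
      simp only [U, ← map_mul, ← map_sum]
      congr 1
      ext r
      simp [Yangian.conv, coeff_mul]
    have cV : ∀ i j, ∑ a, V (S · i a) * V (T · a j) = V (Yangian.conv S T · i j) := by
      intro i j
      ext s r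
      rw [show coeff s (V (Yangian.conv S T · i j)) = C (Yangian.conv S T s i j) from
        coeff_mk _ _]
      rw [map_sum (coeff s)]
      simp only [V, Yangian.conv, coeff_mul, coeff_mk, ← map_mul, ← map_sum]
    simp only [cU, cV] at main
    have h := congrArg (coeff (r + 1)) (congrArg (coeff (s + 1)) main)
    rw [sub_mul, mul_assoc x y, map_sub, map_sub, cx, cx] at h
    simp only [cy, coeff_succ_X_mul, map_sub, hUV, hVU] at h
    simp only [Ring.lie_def]
    exact h

/-- The coproduct `Δ(t_ij(u)) = ∑_a t_ia(u) ⊗ t_aj(u)`. -/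
noncomputable def comul : Yangian n →ₐ[ℂ] Yangian n ⊗[ℂ] Yangian n :=
  lift
    (fun r i j => ∑ a : Fin n, ∑ p ∈ Finset.HasAntidiagonal.antidiagonal r, t p.1 i a ⊗ₜ[ℂ] t p.2 a j) <| by
    have hl : IsRTT fun r (i j : Fin n) => t r i j ⊗ₜ[ℂ] (1 : Yangian n) := by
      refine ⟨fun i j => ?_, fun r s i j k l => ?_⟩
      · rw [isRTT_t.zero]
        split_ifs
        · rfl
        · simp
      · have h := congrArg (Algebra.TensorProduct.includeLeft :
          Yangian n →ₐ[ℂ] Yangian n ⊗[ℂ] Yangian n) (isRTT_t.rel r s i j k l)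
        simpa only [Ring.lie_def, map_sub, map_mul,
          Algebra.TensorProduct.includeLeft_apply] using h
    have hr : IsRTT fun r (i j : Fin n) => (1 : Yangian n) ⊗ₜ[ℂ] t r i j := by
      refine ⟨fun i j => ?_, fun r s i j k l => ?_⟩
      · rw [isRTT_t.zero]
        split_ifs
        · rfl
        · simp
      · have h := congrArg (Algebra.TensorProduct.includeRight :
          Yangian n →ₐ[ℂ] Yangian n ⊗[ℂ] Yangian n) (isRTT_t.rel r s i j k l)
        simpa only [Ring.lie_def, map_sub, map_mul,
          Algebra.TensorProduct.includeRight_apply] using h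
    have h := hl.mul hr (by intros; simp)
    have e : conv (fun r (i j : Fin n) => t r i j ⊗ₜ[ℂ] (1 : Yangian n))
        (fun r (i j : Fin n) => (1 : Yangian n) ⊗ₜ[ℂ] t r i j) =
        fun r i j => ∑ a : Fin n, ∑ p ∈ Finset.HasAntidiagonal.antidiagonal r, t p.1 i a ⊗ₜ[ℂ] t p.2 a j := by
      funext r i j
      simp [conv]
    exact e ▸ h

theorem comul_t (r : ℕ) (i j : Fin n) : comul (t r i j) =
    ∑ a : Fin n, ∑ p ∈ Finset.HasAntidiagonal.antidiagonal r, t p.1 i a ⊗ₜ[ℂ] t p.2 a j :=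
  lift_t _ _ r i j

/-! ### The evaluation homomorphism -/

/-- The standard basis element `E_ij` of `gl_n`. -/
noncomputable def E (i j : Fin n) : Matrix (Fin n) (Fin n) ℂ := Matrix.single i j 1

theorem lie_E (i j k l : Fin n) :
    ⁅E i j, E k l⁆ = (if k = j then E i l else 0) - (if i = l then E k j else 0) := by
  rw [Ring.lie_def]
  unfold E
  congr 1
  · split_ifs with h
    · subst h; simp
    · rw [Matrix.single_mul_single_of_ne _ _ _ _ (Ne.symm h)]
  · split_ifs with h
    · subst h; simp
    · rw [Matrix.single_mul_single_of_ne _ _ _ _ (Ne.symm h)]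

/-- The coefficients of the series `δ_ij + E_ij / (u - a) = δ_ij + ∑_{r ≥ 1} a^(r-1) E_ij u⁻ʳ`
over `U(gl_n)`. -/
noncomputable def evalT (n : ℕ) (a : ℂ) :
    ℕ → Fin n → Fin n → UniversalEnvelopingAlgebra ℂ (Matrix (Fin n) (Fin n) ℂ)
  | 0, i, j => if i = j then 1 else 0
  | r + 1, i, j => a ^ r • UniversalEnvelopingAlgebra.ι ℂ (E i j)

theorem isRTT_evalT (a : ℂ) : IsRTT (evalT n a) where
  zero _ _ := rfl
  rel r s i j k l := by
    have z : ∀ i j : Fin n, evalT n a 0 i j = if i = j then 1 else 0 := fun _ _ => rfl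
    have c0 : ∀ (i j : Fin n) (x : UniversalEnvelopingAlgebra ℂ (Matrix (Fin n) (Fin n) ℂ)),
        ⁅evalT n a 0 i j, x⁆ = 0 := by
      intro i j x; rw [Ring.lie_def, z]; split_ifs <;> simp
    have c0' : ∀ (i j : Fin n) (x : UniversalEnvelopingAlgebra ℂ (Matrix (Fin n) (Fin n) ℂ)),
        ⁅x, evalT n a 0 i j⁆ = 0 := by
      intro i j x; rw [Ring.lie_def, z]; split_ifs <;> simp
    rcases r with _ | r <;> rcases s with _ | s
    · rw [c0, c0']; simp [evalT]
    · rw [c0]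
      simp only [evalT, smul_lie, lie_smul, ← LieHom.map_lie, lie_E]
      split_ifs <;> simp [smul_sub]
    · rw [c0']
      simp only [evalT, smul_lie, lie_smul, ← LieHom.map_lie, lie_E]
      split_ifs <;> simp [smul_sub]
    · simp only [evalT, smul_lie, lie_smul, smul_smul, smul_mul_smul_comm]
      rw [← pow_add, ← pow_add, ← pow_add, ← pow_add,
        show s + (r + 1) = s + 1 + r by omega, add_comm s r]
      simp

/-- The evaluation homomorphism `φ_a : t_ij(u) ↦ δ_ij + E_ij / (u - a)`. -/
noncomputable def eval (a : ℂ) :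
    Yangian n →ₐ[ℂ] UniversalEnvelopingAlgebra ℂ (Matrix (Fin n) (Fin n) ℂ) :=
  lift (evalT n a) (isRTT_evalT a)

theorem eval_t (a : ℂ) (r : ℕ) (i j : Fin n) : eval a (t r i j) = evalT n a r i j :=
  lift_t _ _ r i j

end Yangian

/-! ### Modules over the Yangian -/

/-- A module over the Yangian `Y(n)`: a complex vector space on which `Y(n)` acts. -/
structure YangianModule (n : ℕ) where
  /-- The underlying vector space. -/
  carrier : Type u
  [addCommGroup : AddCommGroup carrier]
  [module : Module ℂ carrier]
  /-- The action of `Y(n)`. -/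
  action : Yangian n →ₐ[ℂ] Module.End ℂ carrier

namespace YangianModule

attribute [instance] addCommGroup module

variable {n : ℕ}

/-- A `Y(n)`-module is irreducible if it is nonzero and its only submodules are `0` and itself. -/
def IsIrreducible (M : YangianModule.{u} n) : Prop :=
  Nontrivial M.carrier ∧
    ∀ N : Submodule ℂ M.carrier, (∀ y : Yangian n, ∀ x ∈ N, M.action y x ∈ N) → N = ⊥ ∨ N = ⊤

/-- The tensor product of two `Y(n)`-modules, on which `Y(n)` acts through the coproduct. -/
noncomputable def tensor (M N : YangianModule.{u} n) : YangianModule.{u} n where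
  carrier := M.carrier ⊗[ℂ] N.carrier
  action := (Module.endTensorEndAlgHom (R := ℂ) (S := ℂ) (A := ℂ)).comp
    ((Algebra.TensorProduct.map M.action N.action).comp Yangian.comul)

/-- The tensor product `M₀ ⊗ M₁ ⊗ ⋯ ⊗ M_m` of `Y(n)`-modules (in this order, bracketed from the
left). -/
noncomputable def tensorFamily : (m : ℕ) → (Fin (m + 1) → YangianModule.{u} n) → YangianModule.{u} n
  | 0, M => M 0
  | m + 1, M => (tensorFamily m fun p => M p.castSucc).tensor (M (Fin.last (m + 1)))

/-- The `Y(n)`-module obtained from a `gl_n`-module `V` by means of the evaluation homomorphism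
`φ_a : Y(n) → U(gl_n)`. -/
noncomputable def evaluation (a : ℂ) (V : Type u) [AddCommGroup V] [Module ℂ V]
    [LieRingModule (Matrix (Fin n) (Fin n) ℂ) V] [LieModule ℂ (Matrix (Fin n) (Fin n) ℂ) V] :
    YangianModule.{u} n where
  carrier := V
  action := (UniversalEnvelopingAlgebra.lift ℂ
    (LieModule.toEnd ℂ (Matrix (Fin n) (Fin n) ℂ) V)).comp (Yangian.eval a)

end YangianModule

/-! ### The `gl_n`-modules `L(λ)` -/

/-- `gl_n`-highest weights: `λ_i - λ_{i+1}` is a non-negative integer for each `i`. -/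
def IsGLHighestWeight {n : ℕ} (lam : Fin n → ℂ) : Prop :=
  ∀ (i : ℕ) (hi : i + 1 < n), ∃ m : ℕ, lam ⟨i, Nat.lt_of_succ_lt hi⟩ - lam ⟨i + 1, hi⟩ = m

/-- `V` is (a model of) `L(λ)`: an irreducible finite-dimensional `gl_n`-module with a highest
vector of weight `λ` with respect to the upper triangular Borel subalgebra. -/
structure IsIrreducibleGLModule {n : ℕ} (lam : Fin n → ℂ) (V : Type u) [AddCommGroup V]
    [Module ℂ V] [LieRingModule (Matrix (Fin n) (Fin n) ℂ) V]
    [LieModule ℂ (Matrix (Fin n) (Fin n) ℂ) V] : Prop where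
  finiteDimensional : FiniteDimensional ℂ V
  irreducible : LieModule.IsIrreducible ℂ (Matrix (Fin n) (Fin n) ℂ) V
  exists_highest : ∃ x : V, x ≠ 0 ∧ (∀ i j : Fin n, i < j → ⁅Yangian.E i j, x⁆ = 0) ∧
    ∀ i : Fin n, ⁅Yangian.E i i, x⁆ = lam i • x

/-! ### Families of operators satisfying the `gl_n` relations -/

/-! Everything rests on the identity `(1 - a u⁻¹)(δ_ij + E_ij/(u - a)) = δ_ij + (E_ij - a δ_ij)
u⁻¹`. The operators `E_ij - a δ_ij` on `L(λ)` again satisfy the `gl_n` relations, leave the same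
subspaces invariant, and have highest weight `λ - a I`; by uniqueness of the irreducible module with
that highest weight they model `L(λ - a I)`. So `L(λ - a I)` at parameter `0` is `L_a(λ)` with every
`t_ij(u)` multiplied by the scalar series `1 - a u⁻¹` (`isTwist_evaluation`).

Scalar series are central, so in `∑ t_ic(u) ⊗ t_cj(u)` they come out in front, and the two tensor
products differ by the product of the factors (`IsTwist.tensor`). This product is invertible, so the
coefficients of either family of series are linear combinations of those of the other: the invariant
subspaces agree (`IsTwist.isIrreducible`).

Uniqueness (`IsGLFamily.exists_equiv`) is Goursat's argument: the submodule of `V ⊕ W` generated by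
the pair of highest vectors is the graph of an isomorphism. What it needs is that the weight space
of the highest weight in this submodule is a line (`IsGLFamily.exists_cyclic`). -/

/-- A family of operators `A i j` on `V` which satisfy the commutation relations of the standard
basis elements `E_ij` of `gl_n`. -/
def IsGLFamily {n : ℕ} {V : Type*} [AddCommGroup V] [Module ℂ V]
    (A : Fin n → Fin n → Module.End ℂ V) : Prop :=
  ∀ i j k l, A i j * A k l - A k l * A i j =
    (if k = j then A i l else 0) - (if i = l then A k j else 0)

/-- A family of operators is simple if its only invariant subspaces are `0` and `V`. -/
def IsSimpleFamily {n : ℕ} {V : Type*} [AddCommGroup V] [Module ℂ V]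
    (A : Fin n → Fin n → Module.End ℂ V) : Prop :=
  ∀ N : Submodule ℂ V, (∀ i j, ∀ x ∈ N, A i j x ∈ N) → N = ⊥ ∨ N = ⊤

/-- The vector `x` is annihilated by the raising operators and has weight `μ`. -/
structure IsHighestVector {n : ℕ} {V : Type*} [AddCommGroup V] [Module ℂ V]
    (A : Fin n → Fin n → Module.End ℂ V) (μ : Fin n → ℂ) (x : V) : Prop where
  raise : ∀ i j, i < j → A i j x = 0
  weight : ∀ i, A i i x = μ i • x

namespace IsGLFamily

variable {n : ℕ} {V W : Type*} [AddCommGroup V] [Module ℂ V] [AddCommGroup W] [Module ℂ W]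
  {A : Fin n → Fin n → Module.End ℂ V} {B : Fin n → Fin n → Module.End ℂ W}

/-! ### Grading and highest weight submodules -/

/-- A grading operator, whose commutator with `A i j` is `(j - i) A i j`. -/
noncomputable def grading (A : Fin n → Fin n → Module.End ℂ V) : Module.End ℂ V :=
  ∑ i : Fin n, (-(i : ℂ)) • A i i

theorem commute_apply (hA : IsGLFamily A) (i j k l : Fin n) (v : V) :
    A i j (A k l v) = A k l (A i j v) +
      ((if k = j then A i l v else 0) - (if i = l then A k j v else 0)) := by
  have h := congrArg (fun F : Module.End ℂ V => F v) (hA i j k l)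
  simp only [LinearMap.sub_apply, Module.End.mul_apply] at h
  rw [← sub_eq_iff_eq_add', h]
  split_ifs <;> simp

theorem grading_apply (hA : IsGLFamily A) (i j : Fin n) (v : V) :
    grading A (A i j v) = A i j (grading A v) + ((j : ℂ) - i) • A i j v := by
  simp only [grading, LinearMap.sum_apply, LinearMap.smul_apply, map_sum, map_smul]
  simp only [hA.commute_apply _ _ i j, smul_add, Finset.sum_add_distrib, smul_sub,
    Finset.sum_sub_distrib, smul_ite, smul_zero]
  congr 1
  rw [Finset.sum_ite_eq, Finset.sum_ite_eq']
  simp only [Finset.mem_univ, if_true, ← sub_smul]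
  congr 1
  ring

theorem grading_highest {μ : Fin n → ℂ} {x : V} (hx : ∀ i, A i i x = μ i • x) :
    grading A x = (∑ i : Fin n, -(i : ℂ) * μ i) • x := by
  simp [grading, hx, Finset.sum_smul, smul_smul]

theorem mem_eigenspace_grading (hA : IsGLFamily A) {c : ℂ} {v : V}
    (hv : v ∈ (grading A).eigenspace c) (i j : Fin n) :
    A i j v ∈ (grading A).eigenspace (c + (j - i)) := by
  rw [Module.End.mem_eigenspace_iff] at hv ⊢
  rw [hA.grading_apply, hv, map_smul, ← add_smul]

/-- The submodule generated by a highest vector: its vectors of the highest weight are the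
multiples of the generator. -/
theorem exists_cyclic (hA : IsGLFamily A) {μ : Fin n → ℂ} {x : V} (hx : IsHighestVector A μ x) :
    ∃ N : Submodule ℂ V, x ∈ N ∧ (∀ i j, ∀ v ∈ N, A i j v ∈ N) ∧
      ∀ v ∈ N, (∀ i, A i i v = μ i • v) → v ∈ Submodule.span ℂ {x} := by
  -- Only lowering and diagonal operators enter the definition, so weights are easy to bound;
  -- stability under raising operators is then proved.
  let S : Set (Submodule ℂ V) := {K | x ∈ K ∧ ∀ i j, j ≤ i → ∀ v ∈ K, A i j v ∈ K}
  have hxN : x ∈ sInf S := Submodule.mem_sInf.2 fun K hK => hK.1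
  have hlow : ∀ i j, j ≤ i → ∀ v ∈ sInf S, A i j v ∈ sInf S := fun i j hij v hv =>
    Submodule.mem_sInf.2 fun K hK => hK.2 i j hij v (Submodule.mem_sInf.1 hv K hK)
  have hle : ∀ K ∈ S, sInf S ≤ K := fun K hK => sInf_le hK
  refine ⟨sInf S, hxN, ?_, ?_⟩
  · let K : Submodule ℂ V := sInf S ⊓ ⨅ i, ⨅ j, (sInf S).comap (A i j)
    have hK : ∀ v, v ∈ K ↔ v ∈ sInf S ∧ ∀ i j, A i j v ∈ sInf S := fun v => by
      simp only [K, Submodule.mem_inf, Submodule.mem_iInf, Submodule.mem_comap]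
    have hKS : K ∈ S := by
      refine ⟨(hK x).2 ⟨hxN, fun i j => ?_⟩, fun i j hij v hv => ?_⟩
      · rcases lt_or_ge i j with h | h
        · rw [hx.raise i j h]; exact zero_mem _
        · exact hlow i j h x hxN
      · rw [hK] at hv ⊢
        refine ⟨hv.2 i j, fun k l => ?_⟩
        rw [hA.commute_apply]
        refine add_mem (hlow i j hij _ (hv.2 k l)) (sub_mem ?_ ?_)
        · split_ifs
          · exact hv.2 _ _
          · exact zero_mem _
        · split_ifs
          · exact hv.2 _ _
          · exact zero_mem _
    exact fun i j v hv => ((hK v).1 (hle K hKS hv)).2 i j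
  · set c : ℂ := ∑ i : Fin n, -(i : ℂ) * μ i with hc
    have hxc : x ∈ (grading A).eigenspace c :=
      Module.End.mem_eigenspace_iff.2 (grading_highest hx.weight)
    -- `x` has degree `c`, and `A i j` with `j < i` lowers the degree by `i - j`; so all else
    -- generated from `x` lies in degrees `c - 1, c - 2, …`.
    let Q : Submodule ℂ V := ⨆ d : ℕ, (grading A).eigenspace (c - (d + 1))
    have hQ : ∀ (d : ℕ), (grading A).eigenspace (c - (d + 1)) ≤ Q := fun d =>
      le_iSup (fun d : ℕ => (grading A).eigenspace (c - (d + 1))) d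
    have hS : Submodule.span ℂ {x} ⊔ Q ∈ S := by
      refine ⟨Submodule.mem_sup_left (Submodule.mem_span_singleton_self x), fun i j hij => ?_⟩
      suffices h : Submodule.span ℂ {x} ⊔ Q ≤ (Submodule.span ℂ {x} ⊔ Q).comap (A i j) from
        fun v hv => h hv
      obtain ⟨d, hd⟩ := Nat.exists_eq_add_of_le (Fin.le_def.1 hij)
      refine sup_le ?_ (iSup_le fun e v hv => ?_)
      · rw [Submodule.span_singleton_le_iff_mem, Submodule.mem_comap]
        rcases d with _ | d
        · obtain rfl : i = j := Fin.ext (by simpa using hd)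
          rw [hx.weight]
          exact Submodule.mem_sup_left
            (Submodule.smul_mem _ _ (Submodule.mem_span_singleton_self x))
        · refine Submodule.mem_sup_right (hQ d ?_)
          have h := hA.mem_eigenspace_grading hxc i j
          rw [hd] at h
          convert h using 2
          push_cast
          ring
      · refine Submodule.mem_sup_right (hQ (e + d) ?_)
        have h := hA.mem_eigenspace_grading hv i j
        rw [hd] at h
        convert h using 2
        push_cast
        ring
    intro v hv hvμ
    obtain ⟨y, hy, z, hz, rfl⟩ := Submodule.mem_sup.1 (hle _ hS hv)
    have hyc : y ∈ (grading A).eigenspace c :=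
      (Submodule.span_singleton_le_iff_mem _ _).2 hxc hy
    have hvc : y + z ∈ (grading A).eigenspace c :=
      Module.End.mem_eigenspace_iff.2 (grading_highest hvμ)
    have hzc : z ∈ (grading A).eigenspace c := by simpa using sub_mem hvc hyc
    -- A vector of weight `μ` has degree `c`, so its component in `Q` vanishes by independence of
    -- eigenspaces.
    have hdisj : Disjoint ((grading A).eigenspace c) Q := by
      refine ((grading A).eigenspaces_iSupIndep c).mono_right (iSup_le fun d => ?_)
      refine le_iSup₂_of_le (f := fun j (_ : j ≠ c) => (grading A).eigenspace j)
        (c - (d + 1)) (fun h => ?_) le_rfl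
      rw [sub_eq_self] at h
      exact Nat.cast_add_one_ne_zero d h
    rw [(Submodule.disjoint_def.1 hdisj) z hzc hz, add_zero]
    exact hy

/-! ### Uniqueness of the simple family of a given highest weight -/

theorem prodMap (hA : IsGLFamily A) (hB : IsGLFamily B) :
    IsGLFamily fun i j => (A i j).prodMap (B i j) := by
  intro i j k l
  refine LinearMap.ext fun v => Prod.ext ?_ ?_
  · have h := congrArg (fun F : Module.End ℂ V => F v.1) (hA i j k l)
    simp only [LinearMap.sub_apply, Module.End.mul_apply] at h
    simp only [LinearMap.sub_apply, Module.End.mul_apply, LinearMap.prodMap_apply, Prod.fst_sub]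
    rw [h]
    split_ifs <;> simp
  · have h := congrArg (fun F : Module.End ℂ W => F v.2) (hB i j k l)
    simp only [LinearMap.sub_apply, Module.End.mul_apply] at h
    simp only [LinearMap.sub_apply, Module.End.mul_apply, LinearMap.prodMap_apply, Prod.snd_sub]
    rw [h]
    split_ifs <;> simp

/-- Two simple families with nonzero highest vectors of the same weight are isomorphic. -/
theorem exists_equiv (hA : IsGLFamily A) (hB : IsGLFamily B) (sA : IsSimpleFamily A)
    (sB : IsSimpleFamily B) {μ : Fin n → ℂ} {x : V} {y : W} (hx : IsHighestVector A μ x)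
    (hy : IsHighestVector B μ y) (hx0 : x ≠ 0) (hy0 : y ≠ 0) :
    ∃ e : V ≃ₗ[ℂ] W, ∀ i j v, e (A i j v) = B i j (e v) := by
  obtain ⟨N, hxy, hN, hw⟩ := (hA.prodMap hB).exists_cyclic (μ := μ) (x := (x, y))
    ⟨fun i j h => by simp [hx.raise i j h, hy.raise i j h],
      fun i => by simp [hx.weight, hy.weight]⟩
  let p : N →ₗ[ℂ] V := LinearMap.fst ℂ V W ∘ₗ N.subtype
  let q : N →ₗ[ℂ] W := LinearMap.snd ℂ V W ∘ₗ N.subtype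
  have hp : Function.Surjective p := by
    rw [← LinearMap.range_eq_top]
    refine (sA _ ?_).resolve_left fun h => hx0 ?_
    · rintro i j _ ⟨v, rfl⟩
      exact ⟨⟨_, hN i j v.1 v.2⟩, rfl⟩
    · have : x ∈ LinearMap.range p := ⟨⟨_, hxy⟩, rfl⟩
      rwa [h, Submodule.mem_bot] at this
  have hq : Function.Surjective q := by
    rw [← LinearMap.range_eq_top]
    refine (sB _ ?_).resolve_left fun h => hy0 ?_
    · rintro i j _ ⟨v, rfl⟩
      exact ⟨⟨_, hN i j v.1 v.2⟩, rfl⟩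
    · have : y ∈ LinearMap.range q := ⟨⟨_, hxy⟩, rfl⟩
      rwa [h, Submodule.mem_bot] at this
  -- If the kernel of the first projection were all of `W`, then `(0, y)` would be a vector of
  -- weight `μ` in `N`, hence a multiple of `(x, y)`, which is impossible as `x` and `y` are
  -- nonzero.
  have hr : N.comap (LinearMap.inr ℂ V W) = ⊥ := by
    refine (sB _ fun i j w hw => ?_).resolve_right fun h => hy0 ?_
    · simpa using hN i j _ (Submodule.mem_comap.1 hw)
    · have hmem : ((0 : V), y) ∈ N := by
        have : y ∈ N.comap (LinearMap.inr ℂ V W) := h ▸ Submodule.mem_top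
        simpa using this
      obtain ⟨c, hc⟩ := Submodule.mem_span_singleton.1 (hw _ hmem fun i => by simp [hy.weight])
      have h1 : c • x = 0 := congrArg Prod.fst hc
      have h2 : c • y = y := congrArg Prod.snd hc
      rw [(smul_eq_zero.1 h1).resolve_right hx0, zero_smul] at h2
      exact h2.symm
  have hl : N.comap (LinearMap.inl ℂ V W) = ⊥ := by
    refine (sA _ fun i j w hw => ?_).resolve_right fun h => hx0 ?_
    · simpa using hN i j _ (Submodule.mem_comap.1 hw)
    · have hmem : (x, (0 : W)) ∈ N := by
        have : x ∈ N.comap (LinearMap.inl ℂ V W) := h ▸ Submodule.mem_top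
        simpa using this
      obtain ⟨c, hc⟩ := Submodule.mem_span_singleton.1 (hw _ hmem fun i => by simp [hx.weight])
      have h1 : c • x = x := congrArg Prod.fst hc
      have h2 : c • y = 0 := congrArg Prod.snd hc
      rw [(smul_eq_zero.1 h2).resolve_right hy0, zero_smul] at h1
      exact h1.symm
  have ip : Function.Injective p := by
    rw [← LinearMap.ker_eq_bot, LinearMap.ker_eq_bot']
    rintro ⟨⟨v, w⟩, hvw⟩ (rfl : v = 0)
    have : w ∈ N.comap (LinearMap.inr ℂ V W) := by simpa using hvw
    rw [hr, Submodule.mem_bot] at this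
    simp [this]
  have iq : Function.Injective q := by
    rw [← LinearMap.ker_eq_bot, LinearMap.ker_eq_bot']
    rintro ⟨⟨v, w⟩, hvw⟩ (rfl : w = 0)
    have : v ∈ N.comap (LinearMap.inl ℂ V W) := by simpa using hvw
    rw [hl, Submodule.mem_bot] at this
    simp [this]
  let eP := LinearEquiv.ofBijective p ⟨ip, hp⟩
  let eQ := LinearEquiv.ofBijective q ⟨iq, hq⟩
  refine ⟨eP.symm.trans eQ, fun i j v => ?_⟩
  obtain ⟨u, rfl⟩ := eP.surjective v
  have h1 : A i j (eP u) = eP ⟨_, hN i j u.1 u.2⟩ := rfl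
  have h2 : B i j (eQ u) = eQ ⟨_, hN i j u.1 u.2⟩ := rfl
  simp only [LinearEquiv.trans_apply]
  rw [h1, eP.symm_apply_apply, eP.symm_apply_apply, h2]

/-! ### Shifting by a scalar, and the operators of a `gl_n`-module -/

/-- Subtracting the scalar `a` from the diagonal operators. -/
theorem sub_scalar (hA : IsGLFamily A) (a : ℂ) :
    IsGLFamily fun i j => A i j - if i = j then algebraMap ℂ (Module.End ℂ V) a else 0 := by
  intro i j k l
  have hcomm : ∀ (P Q : Prop) [Decidable P] [Decidable Q] (F G : Module.End ℂ V),
      (F - if P then algebraMap ℂ (Module.End ℂ V) a else 0) *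
        (G - if Q then algebraMap ℂ (Module.End ℂ V) a else 0) -
      (G - if Q then algebraMap ℂ (Module.End ℂ V) a else 0) *
        (F - if P then algebraMap ℂ (Module.End ℂ V) a else 0) = F * G - G * F := by
    intro P Q _ _ F G
    have hF := Algebra.commutes a F
    have hG := Algebra.commutes a G
    split_ifs <;> simp only [sub_zero, mul_sub, sub_mul, hF, hG] <;> abel
  rw [hcomm, hA]
  -- Both terms on the right are shifted only when `k = j` and `i = l`, and then the two shifts
  -- cancel.
  by_cases h1 : k = j <;> by_cases h2 : i = l
  · subst h1 h2; simp
  · subst h1; simp [h2]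
  · subst h2; simp [h1]
  · simp [h1, h2]

end IsGLFamily

/-- Scalars preserve every subspace, so the shift does not change which subspaces are invariant. -/
theorem IsSimpleFamily.sub_scalar {n : ℕ} {V : Type*} [AddCommGroup V] [Module ℂ V]
    {A : Fin n → Fin n → Module.End ℂ V} (hA : IsSimpleFamily A) (a : ℂ) :
    IsSimpleFamily fun i j => A i j - if i = j then algebraMap ℂ (Module.End ℂ V) a else 0 := by
  intro N hN
  refine hA N fun i j x hx => ?_
  have h := hN i j x hx
  have h' : (if i = j then algebraMap ℂ (Module.End ℂ V) a else 0) x ∈ N := by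
    split_ifs
    · exact N.smul_mem a hx
    · exact zero_mem _
  simpa using add_mem h h'

theorem IsHighestVector.sub_scalar {n : ℕ} {V : Type*} [AddCommGroup V] [Module ℂ V]
    {A : Fin n → Fin n → Module.End ℂ V} {μ : Fin n → ℂ} {x : V} (hx : IsHighestVector A μ x)
    (a : ℂ) :
    IsHighestVector (fun i j => A i j - if i = j then algebraMap ℂ (Module.End ℂ V) a else 0)
      (fun i => μ i - a) x where
  raise i j h := by simp [hx.raise i j h, h.ne]
  weight i := by simp [hx.weight, sub_smul]

/-- The operators by which the basis elements `E_ij` act on a `gl_n`-module. -/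
noncomputable def glOp (n : ℕ) (V : Type*) [AddCommGroup V] [Module ℂ V]
    [LieRingModule (Matrix (Fin n) (Fin n) ℂ) V] [LieModule ℂ (Matrix (Fin n) (Fin n) ℂ) V]
    (i j : Fin n) : Module.End ℂ V :=
  LieModule.toEnd ℂ (Matrix (Fin n) (Fin n) ℂ) V (Yangian.E i j)

section glOp

variable {n : ℕ} {V : Type*} [AddCommGroup V] [Module ℂ V]
  [LieRingModule (Matrix (Fin n) (Fin n) ℂ) V] [LieModule ℂ (Matrix (Fin n) (Fin n) ℂ) V]

theorem isGLFamily_glOp : IsGLFamily (glOp n V) := by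
  intro i j k l
  have h := congrArg (LieModule.toEnd ℂ (Matrix (Fin n) (Fin n) ℂ) V) (Yangian.lie_E i j k l)
  rw [LieHom.map_lie, Ring.lie_def] at h
  simp only [glOp]
  rw [h, map_sub]
  split_ifs <;> simp

/-- The `E_ij` span `gl_n`, so a subspace stable under them is a Lie submodule. -/
theorem isSimpleFamily_glOp (hV : LieModule.IsIrreducible ℂ (Matrix (Fin n) (Fin n) ℂ) V) :
    IsSimpleFamily (glOp n V) := by
  intro N hN
  let L : LieSubmodule ℂ (Matrix (Fin n) (Fin n) ℂ) V :=
    { N with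
      lie_mem := by
        intro X v hv
        rw [Matrix.matrix_eq_sum_single X]
        simp only [sum_lie]
        refine N.sum_mem fun i _ => N.sum_mem fun j _ => ?_
        have h : Matrix.single i j (X i j) = X i j • Yangian.E i j := by
          simp [Yangian.E]
        rw [h, smul_lie]
        exact N.smul_mem _ (hN i j v hv) }
  have hL : L.toSubmodule = N := rfl
  rcases hV.eq_bot_or_eq_top L with h | h
  · left; rw [← hL, h]; rfl
  · right; rw [← hL, h]; rfl

end glOp

/-- The module `L(λ - a I)` is `L(λ)` with the operators `E_ii` shifted by `a`. -/
theorem IsIrreducibleGLModule.exists_equiv {n : ℕ} {lam : Fin n → ℂ} {a : ℂ}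
    {V : Type u} [AddCommGroup V] [Module ℂ V]
    [LieRingModule (Matrix (Fin n) (Fin n) ℂ) V] [LieModule ℂ (Matrix (Fin n) (Fin n) ℂ) V]
    {W : Type v} [AddCommGroup W] [Module ℂ W]
    [LieRingModule (Matrix (Fin n) (Fin n) ℂ) W] [LieModule ℂ (Matrix (Fin n) (Fin n) ℂ) W]
    (hV : IsIrreducibleGLModule lam V) (hW : IsIrreducibleGLModule (fun i => lam i - a) W) :
    ∃ e : W ≃ₗ[ℂ] V, ∀ i j w, e (glOp n W i j w) =
      (glOp n V i j - if i = j then algebraMap ℂ (Module.End ℂ V) a else 0) (e w) := by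
  obtain ⟨x, hx0, hx, hxw⟩ := hV.exists_highest
  obtain ⟨y, hy0, hy, hyw⟩ := hW.exists_highest
  have hx' : IsHighestVector (glOp n V) lam x := ⟨hx, hxw⟩
  exact isGLFamily_glOp.exists_equiv (isGLFamily_glOp.sub_scalar a)
    (isSimpleFamily_glOp hW.irreducible) ((isSimpleFamily_glOp hV.irreducible).sub_scalar a)
    ⟨hy, hyw⟩ (hx'.sub_scalar a) hy0 hx0

/-! ### Twisting the action by a scalar series -/

namespace YangianModule

variable {n : ℕ}

open PowerSeries

/-- The series `t_ij(u)` of operators on a `Y(n)`-module, in the variable `X = u⁻¹`. -/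
noncomputable def series (M : YangianModule.{u} n) (i j : Fin n) :
    (Module.End ℂ M.carrier)⟦X⟧ :=
  PowerSeries.mk fun r => M.action (Yangian.t r i j)

/-- The scalar series `f` as a series of scalar operators. -/
noncomputable def scalarSeries (V : Type u) [AddCommGroup V] [Module ℂ V] (f : ℂ⟦X⟧) :
    (Module.End ℂ V)⟦X⟧ :=
  PowerSeries.map (algebraMap ℂ (Module.End ℂ V)) f

theorem scalarSeries_mul {V : Type u} [AddCommGroup V] [Module ℂ V] (f g : ℂ⟦X⟧) :
    scalarSeries V (f * g) = scalarSeries V f * scalarSeries V g := map_mul _ _ _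

/-- The coefficients are central in the noncommutative ring of operators; swapping the antidiagonal
reverses the Cauchy product. -/
theorem scalarSeries_comm {V : Type u} [AddCommGroup V] [Module ℂ V] (f : ℂ⟦X⟧)
    (G : (Module.End ℂ V)⟦X⟧) : scalarSeries V f * G = G * scalarSeries V f := by
  ext1 r
  rw [coeff_mul, coeff_mul, ← Finset.Nat.sum_antidiagonal_swap]
  refine Finset.sum_congr rfl fun p _ => ?_
  simp only [scalarSeries, coeff_map, Prod.fst_swap, Prod.snd_swap]
  exact Algebra.commutes _ _

/-- Algebra homomorphisms fix scalars, so a twisting series survives both conjugation and the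
passage to a tensor product. -/
theorem map_scalarSeries {V : Type u} [AddCommGroup V] [Module ℂ V] {W : Type v} [AddCommGroup W]
    [Module ℂ W] (φ : Module.End ℂ V →ₐ[ℂ] Module.End ℂ W) (f : ℂ⟦X⟧) :
    PowerSeries.map (φ : Module.End ℂ V →+* Module.End ℂ W) (scalarSeries V f) =
      scalarSeries W f := by
  ext1 r
  simp only [scalarSeries, coeff_map]
  exact φ.commutes _

/-- Conjugation by a linear equivalence, on series of operators. -/
noncomputable def conjSeries {V : Type u} [AddCommGroup V] [Module ℂ V] {W : Type v}
    [AddCommGroup W] [Module ℂ W] (e : V ≃ₗ[ℂ] W) :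
    (Module.End ℂ V)⟦X⟧ →+* (Module.End ℂ W)⟦X⟧ :=
  PowerSeries.map ((e.conjAlgEquiv ℂ).toAlgHom : Module.End ℂ V →+* Module.End ℂ W)

/-- `M` is isomorphic to `N` with the series `t_ij(u)` multiplied by an invertible scalar series. -/
def IsTwist (M : YangianModule.{u} n) (N : YangianModule.{v} n) : Prop :=
  ∃ (e : M.carrier ≃ₗ[ℂ] N.carrier) (f g : ℂ⟦X⟧), f * g = 1 ∧
    ∀ i j, conjSeries e (M.series i j) = scalarSeries N.carrier f * N.series i j

theorem IsTwist.symm {M : YangianModule.{u} n} {N : YangianModule.{v} n} (h : IsTwist M N) :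
    IsTwist N M := by
  obtain ⟨e, f, g, hfg, h⟩ := h
  refine ⟨e.symm, g, f, by rw [mul_comm, hfg], fun i j => ?_⟩
  have h1 : N.series i j = scalarSeries N.carrier g * conjSeries e (M.series i j) := by
    rw [h, ← mul_assoc, ← scalarSeries_mul, mul_comm g, hfg]
    simp [scalarSeries]
  rw [h1, map_mul]
  congr 1
  · exact map_scalarSeries _ _
  · ext r : 2
    simp [conjSeries]

/-- A subspace invariant under all `t_ij^(r)` is a submodule. -/
theorem action_mem (M : YangianModule.{u} n) {K : Submodule ℂ M.carrier}
    (hK : ∀ r i j, ∀ x ∈ K, M.action (Yangian.t r i j) x ∈ K) (y : Yangian n) :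
    ∀ x ∈ K, M.action y x ∈ K := by
  obtain ⟨z, rfl⟩ := RingQuot.mkAlgHom_surjective ℂ (Yangian.Rel n) y
  induction z using FreeAlgebra.induction with
  | grade0 r =>
    intro x hx
    rw [AlgHom.commutes, AlgHom.commutes]
    exact K.smul_mem r hx
  -- The free generator with first index `r` is `t_ij^(r+1)`.
  | grade1 p => exact hK (p.1 + 1) p.2.1 p.2.2
  | mul a b ha hb =>
    intro x hx
    rw [map_mul, map_mul]
    exact ha _ (hb _ hx)
  | add a b ha hb =>
    intro x hx
    rw [map_add, map_add]
    exact add_mem (ha _ hx) (hb _ hx)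

/-- Submodules of `N` pull back along `e` to submodules of `M`. -/
theorem IsTwist.isIrreducible {M : YangianModule.{u} n} {N : YangianModule.{v} n}
    (h : IsTwist M N) (hM : M.IsIrreducible) : N.IsIrreducible := by
  obtain ⟨e, f, g, -, h⟩ := h
  refine ⟨have := hM.1; e.symm.toEquiv.nontrivial, fun K hK => ?_⟩
  have hmem : ∀ r i j, ∀ x ∈ K.comap e.toLinearMap,
      M.action (Yangian.t r i j) x ∈ K.comap e.toLinearMap := by
    intro r i j x hx
    rw [Submodule.mem_comap] at hx ⊢
    -- Comparing coefficients of `u⁻ʳ`: up to `e`, `t_ij^(r)` on `M` is a finite scalar combination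
    -- of the `t_ij^(q)`, `q ≤ r`, on `N`.
    have h1 := congrArg (fun F => F (e x)) (congrArg (coeff r) (h i j))
    simp only [conjSeries, series, scalarSeries, coeff_map, coeff_mul, coeff_mk,
      LinearMap.sum_apply] at h1
    have h2 : e (M.action (Yangian.t r i j) x) =
        (e.conjAlgEquiv ℂ) (M.action (Yangian.t r i j)) (e x) := by
      simp [LinearEquiv.conjAlgEquiv_apply]
    change e (M.action (Yangian.t r i j) x) ∈ K
    rw [h2]
    refine h1.symm ▸ sum_mem fun p _ => K.smul_mem _ (hK _ _ hx)
  rcases hM.2 _ (M.action_mem hmem) with h0 | h0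
  · left
    rw [← Submodule.map_comap_eq_of_surjective (f := e.toLinearMap) e.surjective K, h0,
      Submodule.map_bot]
  · right
    rw [← Submodule.map_comap_eq_of_surjective (f := e.toLinearMap) e.surjective K, h0,
      Submodule.map_top, LinearEquiv.range]

/-! ### Twists of tensor products -/

/-- Operators on the left factor of a tensor product. -/
noncomputable def leftOp (V W : Type u) [AddCommGroup V] [Module ℂ V] [AddCommGroup W]
    [Module ℂ W] : Module.End ℂ V →ₐ[ℂ] Module.End ℂ (V ⊗[ℂ] W) :=
  (Module.endTensorEndAlgHom (R := ℂ) (S := ℂ) (A := ℂ)).comp Algebra.TensorProduct.includeLeft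

/-- Operators on the right factor of a tensor product. -/
noncomputable def rightOp (V W : Type u) [AddCommGroup V] [Module ℂ V] [AddCommGroup W]
    [Module ℂ W] : Module.End ℂ W →ₐ[ℂ] Module.End ℂ (V ⊗[ℂ] W) :=
  (Module.endTensorEndAlgHom (R := ℂ) (S := ℂ) (A := ℂ)).comp Algebra.TensorProduct.includeRight

/-- The action of `Y(n)` on the tensor product of two modules. -/
noncomputable def tensorAction (M N : YangianModule.{u} n) :
    Yangian n →ₐ[ℂ] Module.End ℂ (M.carrier ⊗[ℂ] N.carrier) :=
  (Module.endTensorEndAlgHom (R := ℂ) (S := ℂ) (A := ℂ)).comp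
    ((Algebra.TensorProduct.map M.action N.action).comp Yangian.comul)

/-- The antidiagonal sum in the coproduct is a Cauchy product, so the action becomes a matrix
product of series, from which central factors can be extracted. -/
theorem tensorAction_series (M N : YangianModule.{u} n) (i j : Fin n) :
    (PowerSeries.mk fun r => tensorAction M N (Yangian.t r i j)) = ∑ a : Fin n,
      PowerSeries.map (leftOp M.carrier N.carrier : _ →+* _) (M.series i a) *
        PowerSeries.map (rightOp M.carrier N.carrier : _ →+* _) (N.series a j) := by
  ext1 r
  have h : tensorAction M N (Yangian.t r i j) = ∑ a : Fin n,
      ∑ p ∈ Finset.HasAntidiagonal.antidiagonal r,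
        leftOp M.carrier N.carrier (M.action (Yangian.t p.1 i a)) *
          rightOp M.carrier N.carrier (N.action (Yangian.t p.2 a j)) := by
    simp only [tensorAction, AlgHom.comp_apply, Yangian.comul_t, map_sum,
      Algebra.TensorProduct.map_tmul, leftOp, rightOp, Algebra.TensorProduct.includeLeft_apply,
      Algebra.TensorProduct.includeRight_apply, ← map_mul, Algebra.TensorProduct.tmul_mul_tmul,
      one_mul, mul_one]
  rw [map_sum]
  simp only [coeff_mul, coeff_map, series, coeff_mk]
  exact h

theorem conj_leftOp {V W : Type u} {V' W' : Type v} [AddCommGroup V] [Module ℂ V]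
    [AddCommGroup W] [Module ℂ W] [AddCommGroup V'] [Module ℂ V'] [AddCommGroup W'] [Module ℂ W']
    (e : V ≃ₗ[ℂ] V') (e' : W ≃ₗ[ℂ] W') (F : Module.End ℂ V) :
    (TensorProduct.congr e e').conjAlgEquiv ℂ (leftOp V W F) =
      leftOp V' W' (e.conjAlgEquiv ℂ F) := by
  refine TensorProduct.ext' fun x y => ?_
  simp [LinearEquiv.conjAlgEquiv_apply, leftOp, Module.endTensorEndAlgHom_apply]

theorem conj_rightOp {V W : Type u} {V' W' : Type v} [AddCommGroup V] [Module ℂ V]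
    [AddCommGroup W] [Module ℂ W] [AddCommGroup V'] [Module ℂ V'] [AddCommGroup W'] [Module ℂ W']
    (e : V ≃ₗ[ℂ] V') (e' : W ≃ₗ[ℂ] W') (F : Module.End ℂ W) :
    (TensorProduct.congr e e').conjAlgEquiv ℂ (rightOp V W F) =
      rightOp V' W' (e'.conjAlgEquiv ℂ F) := by
  refine TensorProduct.ext' fun x y => ?_
  simp [LinearEquiv.conjAlgEquiv_apply, rightOp, Module.endTensorEndAlgHom_apply]

theorem IsTwist.tensor {M N : YangianModule.{u} n} {M' N' : YangianModule.{v} n}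
    (h : IsTwist M M') (h' : IsTwist N N') : IsTwist (M.tensor N) (M'.tensor N') := by
  obtain ⟨e, f, g, hfg, h⟩ := h
  obtain ⟨e', f', g', hfg', h'⟩ := h'
  refine ⟨TensorProduct.congr e e', f * f', g * g', ?_, fun i j => ?_⟩
  · rw [mul_mul_mul_comm, hfg, hfg', one_mul]
  have hL : ∀ i a, conjSeries (TensorProduct.congr e e')
      (PowerSeries.map (leftOp M.carrier N.carrier : _ →+* _) (M.series i a)) =
      scalarSeries (M'.carrier ⊗[ℂ] N'.carrier) f *
        PowerSeries.map (leftOp M'.carrier N'.carrier : _ →+* _) (M'.series i a) := by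
    intro i a
    rw [← map_scalarSeries (leftOp M'.carrier N'.carrier) f, ← map_mul, ← h]
    ext1 r
    simp only [conjSeries, coeff_map]
    exact conj_leftOp e e' _
  have hR : ∀ a j, conjSeries (TensorProduct.congr e e')
      (PowerSeries.map (rightOp M.carrier N.carrier : _ →+* _) (N.series a j)) =
      scalarSeries (M'.carrier ⊗[ℂ] N'.carrier) f' *
        PowerSeries.map (rightOp M'.carrier N'.carrier : _ →+* _) (N'.series a j) := by
    intro a j
    rw [← map_scalarSeries (rightOp M'.carrier N'.carrier) f', ← map_mul, ← h']
    ext1 r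
    simp only [conjSeries, coeff_map]
    exact conj_rightOp e e' _
  change conjSeries (TensorProduct.congr e e')
      (PowerSeries.mk fun r => tensorAction M N (Yangian.t r i j)) =
    scalarSeries (M'.carrier ⊗[ℂ] N'.carrier) (f * f') *
      PowerSeries.mk fun r => tensorAction M' N' (Yangian.t r i j)
  rw [tensorAction_series, tensorAction_series, map_sum, Finset.mul_sum]
  refine Finset.sum_congr rfl fun a _ => ?_
  -- Here `f'` is moved to the left past `t_ia(u)`.
  rw [map_mul, hL, hR, scalarSeries_mul, mul_assoc, ← mul_assoc _ (scalarSeries _ f'),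
    ← scalarSeries_comm f']
  simp only [mul_assoc]

theorem IsTwist.tensorFamily : ∀ (m : ℕ) {M : Fin (m + 1) → YangianModule.{u} n}
    {N : Fin (m + 1) → YangianModule.{v} n}, (∀ p, IsTwist (M p) (N p)) →
    IsTwist (tensorFamily m M) (tensorFamily m N)
  | 0, _, _, h => h 0
  | m + 1, _, _, h => (IsTwist.tensorFamily m fun p => h p.castSucc).tensor (h _)

/-! ### Evaluation modules as twists -/

/-- The action of `Y(n)` on a `gl_n`-module by means of `φ_a`. -/
noncomputable def evalAction (a : ℂ) (V : Type u) [AddCommGroup V] [Module ℂ V]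
    [LieRingModule (Matrix (Fin n) (Fin n) ℂ) V] [LieModule ℂ (Matrix (Fin n) (Fin n) ℂ) V] :
    Yangian n →ₐ[ℂ] Module.End ℂ V :=
  (UniversalEnvelopingAlgebra.lift ℂ
    (LieModule.toEnd ℂ (Matrix (Fin n) (Fin n) ℂ) V)).comp (Yangian.eval a)

theorem evalAction_zero (a : ℂ) (V : Type u) [AddCommGroup V] [Module ℂ V]
    [LieRingModule (Matrix (Fin n) (Fin n) ℂ) V] [LieModule ℂ (Matrix (Fin n) (Fin n) ℂ) V]
    (i j : Fin n) : evalAction a V (Yangian.t 0 i j) = if i = j then 1 else 0 := by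
  simp only [evalAction, AlgHom.comp_apply, Yangian.eval_t, Yangian.evalT]
  split_ifs
  · exact map_one _
  · exact map_zero _

theorem evalAction_succ (a : ℂ) (V : Type u) [AddCommGroup V] [Module ℂ V]
    [LieRingModule (Matrix (Fin n) (Fin n) ℂ) V] [LieModule ℂ (Matrix (Fin n) (Fin n) ℂ) V]
    (r : ℕ) (i j : Fin n) :
    evalAction a V (Yangian.t (r + 1) i j) = a ^ r • glOp n V i j := by
  simp only [evalAction, AlgHom.comp_apply, Yangian.eval_t, Yangian.evalT, glOp, map_smul,
    UniversalEnvelopingAlgebra.lift_ι_apply]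

/-- The evaluation modules `L_0(λ - a I)` and `L_a(λ)` differ by the series `1 - a u⁻¹`. -/
theorem isTwist_evaluation {lam : Fin n → ℂ} {a : ℂ}
    {V : Type u} [AddCommGroup V] [Module ℂ V]
    [LieRingModule (Matrix (Fin n) (Fin n) ℂ) V] [LieModule ℂ (Matrix (Fin n) (Fin n) ℂ) V]
    {W : Type v} [AddCommGroup W] [Module ℂ W]
    [LieRingModule (Matrix (Fin n) (Fin n) ℂ) W] [LieModule ℂ (Matrix (Fin n) (Fin n) ℂ) W]
    (hV : IsIrreducibleGLModule lam V) (hW : IsIrreducibleGLModule (fun i => lam i - a) W) :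
    IsTwist (evaluation (n := n) 0 W) (evaluation (n := n) a V) := by
  obtain ⟨e, he⟩ := hV.exists_equiv hW
  have hconj : ∀ i j, e.conjAlgEquiv ℂ (glOp n W i j) =
      glOp n V i j - if i = j then algebraMap ℂ (Module.End ℂ V) a else 0 := by
    intro i j
    refine LinearMap.ext fun v => ?_
    rw [LinearEquiv.conjAlgEquiv_apply]
    exact (he i j (e.symm v)).trans (by rw [e.apply_symm_apply])
  have hf : (1 - C a * X : ℂ⟦X⟧) * (1 - C a * X : ℂ⟦X⟧)⁻¹ = 1 :=
    PowerSeries.mul_inv_cancel _ (by simp)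
  refine ⟨e, 1 - C a * X, _, hf, fun i j => ?_⟩
  have hs : scalarSeries V (1 - C a * X) = 1 - X * C (algebraMap ℂ (Module.End ℂ V) a) := by
    rw [X_mul]
    simp [scalarSeries]
  have key : PowerSeries.map ((e.conjAlgEquiv ℂ).toAlgHom : Module.End ℂ W →+* Module.End ℂ V)
      (PowerSeries.mk fun r => evalAction (n := n) 0 W (Yangian.t r i j)) =
      (1 - X * C (algebraMap ℂ (Module.End ℂ V) a)) *
      (PowerSeries.mk fun r => evalAction (n := n) a V (Yangian.t r i j) :
        (Module.End ℂ V)⟦X⟧) := by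
    ext1 r
    have hδ : (e.conjAlgEquiv ℂ) (evalAction (n := n) 0 W (Yangian.t 0 i j)) =
        if i = j then 1 else 0 := by
      rw [evalAction_zero]
      split_ifs
      · exact map_one _
      · exact map_zero _
    have hE : ∀ r, (e.conjAlgEquiv ℂ) (evalAction (n := n) 0 W (Yangian.t (r + 1) i j)) =
        (0 : ℂ) ^ r • (glOp n V i j - if i = j then algebraMap ℂ (Module.End ℂ V) a else 0) := by
      intro r
      rw [evalAction_succ, ← hconj]
      exact map_smul _ _ _
    rw [sub_mul, one_mul, mul_assoc, map_sub, coeff_map, coeff_mk, coeff_mk]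
    rcases r with _ | r
    · refine hδ.trans ?_
      rw [coeff_zero_X_mul, sub_zero, evalAction_zero]
    · refine (hE r).trans ?_
      rw [coeff_succ_X_mul, coeff_C_mul, coeff_mk]
      -- The coefficient of `u⁻¹` is `E_ij - a δ_ij`, with `0 ^ 0 = 1` on the left. From `u⁻²` on
      -- the left side is `0`, and the right side cancels because the coefficients of `E_ij/(u - a)`
      -- form a geometric progression of ratio `a`.
      rcases r with _ | r
      · rw [evalAction_succ, evalAction_zero, pow_zero, pow_zero, one_smul, one_smul]
        congr 1
        split_ifs
        · exact (mul_one _).symm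
        · exact (mul_zero _).symm
      · rw [evalAction_succ, evalAction_succ, ← Algebra.smul_def]
        refine Eq.trans ?_ (sub_eq_zero.2 ?_).symm
        · simp
        · rw [pow_succ', mul_smul]
  exact key.trans (congrArg (· * _) hs.symm)

end YangianModule


theorem proposition2p5 (n m : ℕ) (a : Fin (m + 1) → ℂ) (lam : Fin (m + 1) → Fin n → ℂ)
    (hlam : ∀ p, IsGLHighestWeight (lam p))
    (V : Fin (m + 1) → Type u) [∀ p, AddCommGroup (V p)] [∀ p, Module ℂ (V p)]
    [∀ p, LieRingModule (Matrix (Fin n) (Fin n) ℂ) (V p)]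
    [∀ p, LieModule ℂ (Matrix (Fin n) (Fin n) ℂ) (V p)]
    (hV : ∀ p, IsIrreducibleGLModule (lam p) (V p))
    (W : Fin (m + 1) → Type v) [∀ p, AddCommGroup (W p)] [∀ p, Module ℂ (W p)]
    [∀ p, LieRingModule (Matrix (Fin n) (Fin n) ℂ) (W p)]
    [∀ p, LieModule ℂ (Matrix (Fin n) (Fin n) ℂ) (W p)]
    (hW : ∀ p, IsIrreducibleGLModule (fun i => lam p i - a p) (W p)) :
    (YangianModule.tensorFamily m fun p =>
        YangianModule.evaluation (n := n) (a p) (V p)).IsIrreducible ↔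
      (YangianModule.tensorFamily m fun p =>
        YangianModule.evaluation (n := n) 0 (W p)).IsIrreducible := by
  have h : YangianModule.IsTwist _ _ := YangianModule.IsTwist.tensorFamily m fun p =>
    YangianModule.isTwist_evaluation (hV p) (hW p)
  -- The twist `h` goes from the product with parameters `0` to the one with parameters `a p`.
  exact ⟨h.symm.isIrreducible, h.isIrreducible⟩
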